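/- **Setting.** Let $\mathcal X,\mathcal A,\mathcal Y$ be finite sets of states, actions and observations; identify each $y\in\mathcal Y$ with its one-hot vector. An *action-controlled HMM* with transition matrices $T(a)$ ($a\in\mathcal A$), emission matrix $E$ and initial distribution $\pi_0$ consists of states $x_0^\star,x_1^\star,\dots$, actions $a_0,a_1,\dots$ and observations $y_1,y_2,\dots$ on a probability space such that $x_0^\star\sim\pi_0$ and, for every $k\ge 0$, $$\mathbb P(x^\star_{k+1}=i\mid x^\star_{0:k},a_{0:k},y_{1:k})=T(a_k)_{i\,x^\star_k},\qquad \mathbb P(y_{k+1}=s\mid x^\star_{0:k+1},a_{0:k},y_{1:k})=E_{s\,x^\star_{k+1}} .$$ Each action may be randomized and may depend in any way on the past. For every $a\in\mathcal A$ let $P(a)$ be a permutation matrix and let $Q(a)$ satisfy, for each column $j$, with $n_j$ the row of the $1$ in column $j$ of $P(a)$: $Q(a)_{ij}\ge 0$ for $i\ne n_j$ and $Q(a)_{n_jj}=-\sum_{i\neq n_j}Q(a)_{ij}$. Let $E$ be column-stochastic with strictly positive entries and pairwise distinct columns. For all sufficiently small $\varepsilon>0$ consider an action-controlled HMM with transition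 matrices $T_\varepsilon(a)=P(a)+\varepsilon Q(a)$, emission matrix $E$ and initial distribution $\pi_0$ (the rule by which actions are chosen may depend on $\varepsilon$). Given $\delta=\delta_\varepsilon>0$ and a vector $w_0\in\mathbb R^{\mathcal X}$, the time-varying adaptive logit filter (ALF) is $$w_k=P(a_{k-1})(1-\delta)\,w_{k-1}+\delta\log(E^\top y_k),\qquad k\ge1,$$ with the logarithm taken entrywise. Its decoding error is $p_k=\mathbb P[\arg\max_{x}\widehat\alpha_k(x)\ne x_k^\star]$, where $\widehat\alpha_k=\mathrm{softmax}(w_k)$ and a tie for the maximum counts as an error. **Theorem.** 1. If $\delta_\varepsilon\to0$ and $\varepsilon/\delta_\varepsilon\to0$ as $\varepsilon\downarrow0$, then $\displaystyle\lim_{\varepsilon\downarrow0}\limsup_{k\to\infty}p_k=0$. 2. There is a constant $\xi>0$, depending only on $(P(a))_{a\in\mathcal A}$ and $E$, such that for every $\lambda\in(0,\xi)$ the choice $\delta_\varepsilon=\lambda/\log(1/\varepsilon)$ gives $$\limsup_{k\to\infty}p_k\le\kappa\,\varepsilon\log\tfrac1\varepsilon+o\!\left(\varepsilon\log\tfrac1\varepsilon\right)\qquad(\varepsilon\downarrow0),$$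 with a constant $\kappa>0$ that depends only on $(P(a))_a$, $(Q(a))_a$, $E$, $w_0$ and $\lambda$. 3. The long-run error of the Bayes-optimal decoder is dominated by a term of the same order: if $\alpha_k(x)=\mathbb P(x_k^\star=x\mid y_{1:k},a_{0:k-1})$ and $b_k=\mathbb P[\arg\max_x\alpha_k(x)\ne x_k^\star]$ (ties again counting as errors), then $\limsup_{k\to\infty}b_k\le\kappa'\varepsilon\log\frac1\varepsilon+o(\varepsilon\log\frac1\varepsilon)$ as $\varepsilon\downarrow0$, with a constant $\kappa'>0$ that depends only on $(P(a))_a$, $(Q(a))_a$ and $E$. -/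

import Mathlib

open Filter Topology Matrix MeasureTheory Asymptotics

universe u v

/-- A permutation matrix with real entries. -/
def IsPermutationMatrix {X : Type*} [DecidableEq X] (P : Matrix X X ℝ) : Prop :=
  ∃ σ : Equiv.Perm X, P = σ.permMatrix ℝ

/-- `Q` is an admissible drift for the deterministic matrix `D`: in every column `j`, with `n` the
row of the unique `1` of `D` in that column, `Q i j ≥ 0` for `i ≠ n`, and
`Q n j = - ∑_{i ≠ n} Q i j`. -/
def IsDrift {X : Type*} [Fintype X] [DecidableEq X] (D Q : Matrix X X ℝ) : Prop :=
  ∀ j n, D n j = 1 →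
    (∀ i, i ≠ n → 0 ≤ Q i j) ∧ Q n j = -∑ i ∈ Finset.univ.erase n, Q i j

/-- An emission matrix: `E s j` is the probability of observing `s` in state `j`. -/
def IsEmissionMatrix {X Y : Type*} [Fintype Y] (E : Matrix Y X ℝ) : Prop :=
  (∀ s j, 0 ≤ E s j) ∧ ∀ j, ∑ s, E s j = 1

/-- Three discrete-time processes on a probability space: states `x k` and actions `a k` for
`k ≥ 0`, observations `y k` for `k ≥ 1` (the value `y 0` is never used). -/
structure ControlledProcess (X A Y : Type v) where
  Ω : Type u
  mΩ : MeasurableSpace Ω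
  μ : @Measure Ω mΩ
  prob : @IsProbabilityMeasure Ω mΩ μ
  x : ℕ → Ω → X
  a : ℕ → Ω → A
  y : ℕ → Ω → Y
  measurable_x : ∀ k i, @MeasurableSet Ω mΩ {ω | x k ω = i}
  measurable_a : ∀ k b, @MeasurableSet Ω mΩ {ω | a k ω = b}
  measurable_y : ∀ k s, @MeasurableSet Ω mΩ {ω | y k ω = s}

attribute [instance] ControlledProcess.mΩ ControlledProcess.prob

namespace ControlledProcess

variable {X A Y : Type v}

/-- The event that states and actions up to time `k` and observations at times `1, …, k` have
the values prescribed by `ξ`, `α`, `υ`. -/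
def past (H : ControlledProcess.{u} X A Y) (k : ℕ) (ξ : ℕ → X) (α : ℕ → A) (υ : ℕ → Y) :
    Set H.Ω :=
  {ω | (∀ i ≤ k, H.x i ω = ξ i) ∧ (∀ i ≤ k, H.a i ω = α i) ∧
    ∀ i, 1 ≤ i → i ≤ k → H.y i ω = υ i}

/-- The law of an action-controlled hidden Markov model. Given the whole past, including the
current action, the next state has the distribution given by column `x k` of `T (a k)`; given in
addition the next state, the next observation is drawn from the corresponding column of `E`.
Nothing is asked of the actions: each may be randomized and may depend on the whole past. -/
structure IsActionControlledHMM (H : ControlledProcess.{u} X A Y) (T : A → Matrix X X ℝ)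
    (E : Matrix Y X ℝ) (π₀ : X → ℝ) : Prop where
  init : ∀ i, H.μ.real {ω | H.x 0 ω = i} = π₀ i
  transition : ∀ k ξ α υ,
    H.μ.real (H.past k ξ α υ ∩ {ω | H.x (k + 1) ω = ξ (k + 1)}) =
      T (α k) (ξ (k + 1)) (ξ k) * H.μ.real (H.past k ξ α υ)
  emission : ∀ k ξ α υ,
    H.μ.real (H.past k ξ α υ ∩ {ω | H.x (k + 1) ω = ξ (k + 1)} ∩
        {ω | H.y (k + 1) ω = υ (k + 1)}) =
      E (υ (k + 1)) (ξ (k + 1)) *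
        H.μ.real (H.past k ξ α υ ∩ {ω | H.x (k + 1) ω = ξ (k + 1)})

end ControlledProcess

noncomputable section

/-- The one-hot vector of an observation. -/
def oneHot {Y : Type*} [DecidableEq Y] (s : Y) : Y → ℝ := Pi.single s 1

/-- `softmax w = exp w / (𝟙ᵀ exp w)`, entrywise. -/
def softmax {X : Type*} [Fintype X] (w : X → ℝ) : X → ℝ :=
  fun i => Real.exp (w i) / ∑ j, Real.exp (w j)

/-- The set of all maximizers. -/
def argmaxSet {X : Type*} (w : X → ℝ) : Set X := {i | ∀ j, w j ≤ w i}

namespace ControlledProcess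

variable {X A Y : Type v} [Fintype X] [Fintype Y] [DecidableEq Y]

/-- The time-varying adaptive logit filter
`w_{k+1} = P(a_k) (1 - δ) w_k + δ log (Eᵀ y_{k+1})`, started at `w₀`. -/
def alf (H : ControlledProcess.{u} X A Y) (P : A → Matrix X X ℝ) (E : Matrix Y X ℝ)
    (w₀ : X → ℝ) (δ : ℝ) : ℕ → H.Ω → X → ℝ
  | 0, _ => w₀
  | k + 1, ω =>
      P (H.a k ω) *ᵥ ((1 - δ) • H.alf P E w₀ δ k ω) +
        δ • fun i => Real.log ((Eᵀ *ᵥ oneHot (H.y (k + 1) ω)) i)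

/-- The probability `p_k` that the argmax of the proxy belief `softmax (w_k)` is not the true
state; a tie for the maximum counts as an error. -/
def alfError (H : ControlledProcess.{u} X A Y) (P : A → Matrix X X ℝ) (E : Matrix Y X ℝ)
    (w₀ : X → ℝ) (δ : ℝ) (k : ℕ) : ℝ :=
  H.μ.real {ω | argmaxSet (softmax (H.alf P E w₀ δ k ω)) ≠ {H.x k ω}}

end ControlledProcess

namespace ControlledProcess

variable {X A Y : Type v}

/-- The event that the observations `y_1, …, y_k` and the actions `a_0, …, a_{k-1}` are the same
as on `ω`. -/
def observedHistory (H : ControlledProcess.{u} X A Y) (k : ℕ) (ω : H.Ω) : Set H.Ω :=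
  {ω' | (∀ i, 1 ≤ i → i ≤ k → H.y i ω' = H.y i ω) ∧ ∀ i < k, H.a i ω' = H.a i ω}

/-- The belief vector: the conditional distribution of `x_k` given `y_1, …, y_k` and
`a_0, …, a_{k-1}`. -/
def belief (H : ControlledProcess.{u} X A Y) (k : ℕ) (ω : H.Ω) : X → ℝ :=
  fun i => (ProbabilityTheory.cond H.μ (H.observedHistory k ω)).real {ω' | H.x k ω' = i}

/-- The error probability of the Bayes-optimal (maximum a posteriori) decoder; a tie for the
maximum counts as an error. -/
def bayesError (H : ControlledProcess.{u} X A Y) (k : ℕ) : ℝ :=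
  H.μ.real {ω | argmaxSet (H.belief k ω) ≠ {H.x k ω}}

end ControlledProcess

end

/-
As long as the state moves by the permutations `P a`, each log-likelihood margin `w x - w z` between
the true state `x` and a competitor `z` is multiplied by `1 - δ` and increased by `δ` times a
log-likelihood ratio. By Jensen's inequality, for `θ δ ≤ 1 / 2` the conditional expectation of
`exp (-θ δ log (E s x / E s z))` is at most the power `2 θ δ` of a Bhattacharyya coefficient, which
is below `1` because the columns of `E` differ. Thus an exponential moment of the margins contracts,
the initial margin is forgotten after `c / δ` steps, and Markov's inequality with `θ = 1 / (2 δ)`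
bounds the error by a multiple of `exp (-ℓ / (2 δ))`. A deviation from `P` within these `c / δ`
steps has probability `O(ε / δ)`. With `δ = λ / log (1 / ε)` both terms are `O(ε log (1 / ε))`.
The maximum a posteriori decoder errs at most twice as often as any other decoder based on the
same data (twice, since ties count as errors), so it inherits this rate.
-/

section FiniteValued

variable {Ω ι Z : Type*} [MeasurableSpace Ω] {μ : Measure Ω} {h : Ω → ι}

theorem measurableSet_of_factorsThrough_finite [Finite ι]
    (hh : ∀ c, MeasurableSet (h ⁻¹' {c})) {p : Ω → Prop} (hp : p.FactorsThrough h) :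
    MeasurableSet {ω | p ω} := by
  let _ : MeasurableSpace ι := ⊤
  obtain ⟨q, rfl⟩ := (Function.factorsThrough_iff p).1 hp
  exact measurable_to_countable' hh (MeasurableSet.of_discrete (s := {c | q c}))

variable [IsFiniteMeasure μ]

theorem integrable_of_factorsThrough_finite [Finite ι] (hh : ∀ c, MeasurableSet (h ⁻¹' {c}))
    {F : Ω → ℝ} (hF : F.FactorsThrough h) : Integrable F μ := by
  let _ : MeasurableSpace ι := ⊤
  obtain ⟨f, rfl⟩ := (Function.factorsThrough_iff F).1 hF
  exact Integrable.of_finite.comp_measurable (measurable_to_countable' hh)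

theorem integral_comp_eq_sum_fiber [Fintype ι] (hh : ∀ c, MeasurableSet (h ⁻¹' {c}))
    (f : ι → ℝ) : ∫ ω, f (h ω) ∂μ = ∑ c, μ.real (h ⁻¹' {c}) * f c := by
  let _ : MeasurableSpace ι := ⊤
  have hm : Measurable h := measurable_to_countable' hh
  rw [← integral_map hm.aemeasurable Measurable.of_discrete.aestronglyMeasurable,
    integral_fintype Integrable.of_finite]
  simp only [map_measureReal_apply hm (measurableSet_singleton _), smul_eq_mul]

theorem integral_eq_integral_sum_condLaw [Finite ι] [Fintype Z]
    (hh : ∀ c, MeasurableSet (h ⁻¹' {c})) {y : Ω → Z} (hy : ∀ s, MeasurableSet {ω | y ω = s})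
    {p : ι → Z → ℝ}
    (hp : ∀ ω s, μ.real (h ⁻¹' {h ω} ∩ {ω' | y ω' = s}) = p (h ω) s * μ.real (h ⁻¹' {h ω}))
    {G : Ω → Z → ℝ} (hG : ∀ s, (G · s).FactorsThrough h) :
    ∫ ω, G ω (y ω) ∂μ = ∫ ω, ∑ s, p (h ω) s * G ω s ∂μ := by
  have _ := Fintype.ofFinite ι
  have hG' : G.FactorsThrough h := fun ω ω' e => funext fun s => hG s e
  obtain ⟨g, rfl⟩ := (Function.factorsThrough_iff G).1 hG'
  have hpair (c : ι × Z) :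
      (fun ω => (h ω, y ω)) ⁻¹' {c} = h ⁻¹' {c.1} ∩ {ω | y ω = c.2} := by
    ext ω
    simp [Prod.ext_iff]
  have hfiber (c : ι) (s : Z) :
      μ.real (h ⁻¹' {c} ∩ {ω | y ω = s}) = p c s * μ.real (h ⁻¹' {c}) := by
    obtain hc | ⟨ω, hω⟩ := (h ⁻¹' {c}).eq_empty_or_nonempty
    · simp [hc]
    · obtain rfl : h ω = c := hω
      exact hp ω s
  calc ∫ ω, g (h ω) (y ω) ∂μ
      = ∑ c : ι × Z, μ.real (h ⁻¹' {c.1} ∩ {ω | y ω = c.2}) * g c.1 c.2 := by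
        rw [integral_comp_eq_sum_fiber (h := fun ω => (h ω, y ω)) (f := fun c => g c.1 c.2)
          fun c => hpair c ▸ (hh c.1).inter (hy c.2)]
        simp only [hpair]
    _ = ∑ c, μ.real (h ⁻¹' {c}) * ∑ s, p c s * g c s := by
        simp only [Fintype.sum_prod_type, hfiber, Finset.mul_sum]
        refine Finset.sum_congr rfl fun c _ => Finset.sum_congr rfl fun s _ => ?_
        ring
    _ = ∫ ω, ∑ s, p (h ω) s * g (h ω) s ∂μ := (integral_comp_eq_sum_fiber hh _).symm

end FiniteValued

section Bhattacharyya

variable {Y : Type*} [Fintype Y] {p q : Y → ℝ}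

/-- The Bhattacharyya coefficient of two probability vectors, which measures how hard they are to
tell apart from samples. -/
noncomputable def bhattacharyya (p q : Y → ℝ) : ℝ := ∑ s, √(p s * q s)

theorem bhattacharyya_nonneg (p q : Y → ℝ) : 0 ≤ bhattacharyya p q :=
  Finset.sum_nonneg fun _ _ => Real.sqrt_nonneg _

theorem bhattacharyya_lt_one (hp : p ∈ stdSimplex ℝ Y) (hq : q ∈ stdSimplex ℝ Y) (hpq : p ≠ q) :
    bhattacharyya p q < 1 := by
  obtain ⟨t, ht⟩ := Function.ne_iff.1 hpq
  have hsqrt : √(p t) - √(q t) ≠ 0 :=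
    sub_ne_zero.2 fun h => ht ((Real.sqrt_inj (hp.1 t) (hq.1 t)).1 h)
  have hpos : 0 < ∑ s, (√(p s) - √(q s)) ^ 2 :=
    Finset.sum_pos' (fun s _ => sq_nonneg _) ⟨t, Finset.mem_univ t, pow_two_pos_of_ne_zero hsqrt⟩
  have hsq (s : Y) : (√(p s) - √(q s)) ^ 2 = p s + q s - 2 * √(p s * q s) := by
    rw [sub_sq, Real.sq_sqrt (hp.1 s), Real.sq_sqrt (hq.1 s), Real.sqrt_mul (hp.1 s)]
    ring
  have hsum : ∑ s, (√(p s) - √(q s)) ^ 2 = 2 - 2 * bhattacharyya p q := by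
    simp only [hsq, Finset.sum_sub_distrib, Finset.sum_add_distrib, hp.2, hq.2, ← Finset.mul_sum,
      bhattacharyya]
    ring
  linarith

theorem sum_mul_exp_logRatio_le_bhattacharyya_rpow (hp : p ∈ stdSimplex ℝ Y) (hp₀ : ∀ s, 0 < p s)
    (hq₀ : ∀ s, 0 < q s) {θ : ℝ} (hθ₀ : 0 ≤ θ) (hθ : θ ≤ 1 / 2) :
    ∑ s, p s * Real.exp (-θ * (Real.log (p s) - Real.log (q s))) ≤
      bhattacharyya p q ^ (2 * θ) := by
  have hhalf (s : Y) :
      p s * Real.exp (-(1 / 2) * (Real.log (p s) - Real.log (q s))) = √(p s * q s) := by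
    rw [Real.sqrt_eq_rpow, Real.rpow_def_of_pos (mul_pos (hp₀ s) (hq₀ s)),
      Real.log_mul (hp₀ s).ne' (hq₀ s).ne']
    nth_rewrite 1 [← Real.exp_log (hp₀ s)]
    rw [← Real.exp_add]
    ring_nf
  have jensen := (Real.concaveOn_rpow (p := 2 * θ) (by linarith) (by linarith)).le_map_sum
    (t := Finset.univ) (w := p)
    (p := fun s => Real.exp (-(1 / 2) * (Real.log (p s) - Real.log (q s))))
    (fun s _ => hp.1 s) hp.2 (fun s _ => (Real.exp_pos _).le)
  simp only [smul_eq_mul, ← Real.exp_mul, hhalf] at jensen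
  refine le_of_eq_of_le (Finset.sum_congr rfl fun s _ => ?_) jensen
  ring_nf

variable {X : Type*} {E : Matrix Y X ℝ}

/-- `ℓ` is a lower bound for the Bhattacharyya distances between the columns of `E`, that is, for
the rate at which observations discriminate any two states. -/
def IsSeparationExponent (E : Matrix Y X ℝ) (ℓ : ℝ) : Prop :=
  ∀ ⦃i j⦄, i ≠ j → bhattacharyya (E.col i) (E.col j) ≤ Real.exp (-ℓ)

theorem IsEmissionMatrix.col_mem_stdSimplex (hE : IsEmissionMatrix E) (j : X) :
    E.col j ∈ stdSimplex ℝ Y :=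
  ⟨fun s => hE.1 s j, hE.2 j⟩

theorem exists_isSeparationExponent [Finite X] (hE : IsEmissionMatrix E)
    (hE_col : ∀ i j, i ≠ j → E.col i ≠ E.col j) : ∃ ℓ, 0 < ℓ ∧ IsSeparationExponent E ℓ := by
  have hexp : Tendsto (fun ℓ : ℝ => Real.exp (-ℓ)) (𝓝[>] 0) (𝓝 1) := by
    have hcont : Continuous fun ℓ : ℝ => Real.exp (-ℓ) := by fun_prop
    simpa using (hcont.tendsto 0).mono_left nhdsWithin_le_nhds
  have hsep : ∀ᶠ ℓ in 𝓝[>] (0 : ℝ), IsSeparationExponent E ℓ := by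
    refine eventually_all.2 fun i => eventually_all.2 fun j => eventually_imp_distrib_left.2
      fun hij => ?_
    have hlt := bhattacharyya_lt_one (hE.col_mem_stdSimplex i) (hE.col_mem_stdSimplex j)
      (hE_col i j hij)
    filter_upwards [hexp.eventually_const_lt hlt] with ℓ hℓ using hℓ.le
  obtain ⟨ℓ, hℓ, hℓ₀⟩ := (hsep.and self_mem_nhdsWithin).exists
  exact ⟨ℓ, hℓ₀, hℓ⟩

theorem IsSeparationExponent.sum_mul_exp_logRatio_le {ℓ : ℝ} (hℓ : IsSeparationExponent E ℓ)
    (hE : IsEmissionMatrix E) (hE_pos : ∀ s j, 0 < E s j) {i j : X} (hij : i ≠ j) {θ : ℝ}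
    (hθ₀ : 0 ≤ θ) (hθ : θ ≤ 1 / 2) :
    ∑ s, E s i * Real.exp (-θ * (Real.log (E s i) - Real.log (E s j))) ≤
      Real.exp (-(2 * θ * ℓ)) :=
  calc _ ≤ bhattacharyya (E.col i) (E.col j) ^ (2 * θ) :=
        sum_mul_exp_logRatio_le_bhattacharyya_rpow (hE.col_mem_stdSimplex i) (hE_pos · i)
          (hE_pos · j) hθ₀ hθ
    _ ≤ Real.exp (-ℓ) ^ (2 * θ) :=
        Real.rpow_le_rpow (bhattacharyya_nonneg _ _) (hℓ hij) (by linarith)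
    _ = _ := by
        rw [← Real.exp_mul]
        ring_nf

end Bhattacharyya

section Argmax

variable {X : Type*} {w : X → ℝ} {x : X}

theorem argmaxSet_eq_of_le_iff_le {v : X → ℝ} (h : ∀ i j, v i ≤ v j ↔ w i ≤ w j) :
    argmaxSet v = argmaxSet w :=
  Set.ext fun i => forall_congr' fun j => h j i

theorem argmaxSet_softmax [Fintype X] (w : X → ℝ) : argmaxSet (softmax w) = argmaxSet w := by
  refine argmaxSet_eq_of_le_iff_le fun i j => ?_
  have hpos : 0 < ∑ j, Real.exp (w j) :=
    Finset.sum_pos (fun j _ => Real.exp_pos _) ⟨i, Finset.mem_univ i⟩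
  simp only [softmax, div_le_div_iff_of_pos_right hpos, Real.exp_le_exp]

theorem exists_ne_le_of_argmaxSet_ne_singleton (h : argmaxSet w ≠ {x}) :
    ∃ z, z ≠ x ∧ w x ≤ w z := by
  by_contra! hlt
  refine h (Set.eq_singleton_iff_unique_mem.2 ⟨fun j => ?_, fun j hj => ?_⟩)
  · obtain rfl | hj := eq_or_ne j x
    exacts [le_rfl, (hlt j hj).le]
  · by_contra hne
    exact (hlt j hne).not_ge (hj x)

variable [Fintype X] [DecidableEq X]

omit [DecidableEq X] in
open Classical in
theorem sum_argmaxSet_ne_singleton_le (hw : 0 ≤ w) (W : Set X) :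
    ∑ i with argmaxSet w ≠ {i}, w i ≤ 2 * ∑ i with W ≠ {i}, w i := by
  have hle : ∑ i with argmaxSet w ≠ {i}, w i ≤ ∑ i, w i :=
    Finset.sum_le_univ_sum_of_nonneg hw
  by_cases hW : ∃ x, W = {x}
  · obtain ⟨x, rfl⟩ := hW
    simp only [ne_eq, Set.singleton_eq_singleton_iff]
    by_cases hx : argmaxSet w = {x}
    · have hnonneg : 0 ≤ ∑ i with ¬x = i, w i := Finset.sum_nonneg fun i _ => hw i
      simp only [hx, Set.singleton_eq_singleton_iff]
      linarith
    · -- Some `z ≠ x` has `w x ≤ w z`, so missing `x` costs at least half of the mass.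
      obtain ⟨z, hzx, hz⟩ := exists_ne_le_of_argmaxSet_ne_singleton hx
      have hsplit := Finset.sum_filter_add_sum_filter_not Finset.univ (fun i => x = i) w
      have hz' : w z ≤ ∑ i with ¬x = i, w i :=
        Finset.single_le_sum (fun i _ => hw i) (by simpa using hzx.symm)
      simp only [Finset.filter_eq, Finset.mem_univ, if_true, Finset.sum_singleton] at hsplit
      linarith
  · have hall : Finset.univ.filter (fun i => W ≠ {i}) = Finset.univ :=
      Finset.filter_true_of_mem fun i _ hi => hW ⟨i, hi⟩
    have hnonneg : 0 ≤ ∑ i, w i := Finset.sum_nonneg fun i _ => hw i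
    rw [hall]
    linarith

/-- The exponential penalty `∑_{z ≠ x} exp (-θ (w x - w z))` on logits `w` that fail to single out
the state `x`; it dominates the indicator of a decoding error. -/
noncomputable def errorPotential (θ : ℝ) (w : X → ℝ) (x : X) : ℝ :=
  ∑ z with z ≠ x, Real.exp (-θ * (w x - w z))

theorem errorPotential_nonneg (θ : ℝ) (w : X → ℝ) (x : X) : 0 ≤ errorPotential θ w x :=
  Finset.sum_nonneg fun _ _ => (Real.exp_pos _).le

theorem one_le_errorPotential {θ : ℝ} (hθ : 0 ≤ θ) (h : argmaxSet w ≠ {x}) :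
    1 ≤ errorPotential θ w x := by
  obtain ⟨z, hz, hle⟩ := exists_ne_le_of_argmaxSet_ne_singleton h
  calc 1 ≤ Real.exp (-θ * (w x - w z)) := Real.one_le_exp_iff.2 (by nlinarith)
    _ ≤ _ := Finset.single_le_sum (f := fun z => Real.exp (-θ * (w x - w z)))
        (fun _ _ => (Real.exp_pos _).le) (by simpa using hz)

theorem errorPotential_le {θ L : ℝ} (hθ : 0 ≤ θ) (hw : ‖w‖ ≤ L) (x : X) :
    errorPotential θ w x ≤ Fintype.card X * Real.exp (2 * θ * L) := by
  have habs (i : X) := abs_le.1 ((norm_le_pi_norm w i).trans hw)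
  calc _ ≤ ∑ z with z ≠ x, Real.exp (2 * θ * L) :=
        Finset.sum_le_sum fun z _ => Real.exp_le_exp.2 (by nlinarith [habs x, habs z])
    _ ≤ ∑ z : X, Real.exp (2 * θ * L) :=
        Finset.sum_le_univ_sum_of_nonneg fun _ => (Real.exp_pos _).le
    _ = _ := by simp

theorem errorPotential_comp_perm (θ : ℝ) (w : X → ℝ) (τ : Equiv.Perm X) (x : X) :
    errorPotential θ (w ∘ τ) x = errorPotential θ w (τ x) := by
  refine Finset.sum_equiv τ (fun z => ?_) fun z _ => rfl
  simp

/-- One step of the adaptive logit filter: the logits `w` are discounted and transported by `τ`, and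
the likelihoods `e` of the new observation are added. -/
noncomputable def logitStep (τ : Equiv.Perm X) (δ : ℝ) (w e : X → ℝ) : X → ℝ :=
  fun i => (1 - δ) * w (τ i) + δ * Real.log (e i)

omit [DecidableEq X] in
theorem norm_logitStep_le {τ : Equiv.Perm X} {δ L : ℝ} (hδ₀ : 0 ≤ δ) (hδ₁ : δ ≤ 1) {w e : X → ℝ}
    (hw : ‖w‖ ≤ L) (he : ‖fun i => Real.log (e i)‖ ≤ L) : ‖logitStep τ δ w e‖ ≤ L := by
  refine (pi_norm_le_iff_of_nonneg ((norm_nonneg w).trans hw)).2 fun i => ?_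
  have hwi := (norm_le_pi_norm w (τ i)).trans hw
  have hei := (norm_le_pi_norm _ i).trans he
  calc ‖logitStep τ δ w e i‖ ≤ (1 - δ) * ‖w (τ i)‖ + δ * ‖Real.log (e i)‖ := by
        refine (norm_add_le _ _).trans_eq ?_
        rw [norm_mul, norm_mul, Real.norm_of_nonneg hδ₀, Real.norm_of_nonneg (sub_nonneg.2 hδ₁)]
    _ ≤ (1 - δ) * L + δ * L := by gcongr
    _ = L := by ring

theorem errorPotential_logitStep (τ : Equiv.Perm X) (δ θ : ℝ) (w e : X → ℝ) (x : X) :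
    errorPotential θ (logitStep τ δ w e) x =
      ∑ z with z ≠ x, Real.exp (-((1 - δ) * θ) * (w (τ x) - w (τ z))) *
        Real.exp (-(θ * δ) * (Real.log (e x) - Real.log (e z))) := by
  refine Finset.sum_congr rfl fun z _ => ?_
  rw [← Real.exp_add, logitStep, logitStep]
  ring_nf

theorem sum_mul_errorPotential_logitStep_le {Y : Type*} [Fintype Y] {E : Matrix Y X ℝ} {ℓ : ℝ}
    (hE : IsEmissionMatrix E) (hE_pos : ∀ s j, 0 < E s j) (hℓ : IsSeparationExponent E ℓ)
    {θ δ : ℝ} (hθ₀ : 0 ≤ θ * δ) (hθ : θ * δ ≤ 1 / 2) (τ : Equiv.Perm X) (w : X → ℝ) (x : X) :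
    ∑ s, E s x * errorPotential θ (logitStep τ δ w (E s)) x ≤
      Real.exp (-(2 * (θ * δ) * ℓ)) * errorPotential ((1 - δ) * θ) w (τ x) := by
  calc _ = ∑ z with z ≠ x, Real.exp (-((1 - δ) * θ) * (w (τ x) - w (τ z))) *
          ∑ s, E s x * Real.exp (-(θ * δ) * (Real.log (E s x) - Real.log (E s z))) := by
        simp only [errorPotential_logitStep, Finset.mul_sum]
        rw [Finset.sum_comm]
        refine Finset.sum_congr rfl fun z _ => Finset.sum_congr rfl fun s _ => ?_
        ring
    _ ≤ ∑ z with z ≠ x, Real.exp (-((1 - δ) * θ) * (w (τ x) - w (τ z))) *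
          Real.exp (-(2 * (θ * δ) * ℓ)) := by
        refine Finset.sum_le_sum fun z hz => mul_le_mul_of_nonneg_left ?_ (Real.exp_pos _).le
        exact hℓ.sum_mul_exp_logRatio_le hE hE_pos (Finset.mem_filter.1 hz).2.symm hθ₀ hθ
    _ = Real.exp (-(2 * (θ * δ) * ℓ)) * errorPotential ((1 - δ) * θ) (w ∘ τ) x := by
        rw [← Finset.sum_mul, mul_comm]
        rfl
    _ = _ := by rw [errorPotential_comp_perm]

end Argmax

section MaximumAPosteriori

variable {Ω ι X : Type*} [MeasurableSpace Ω] {μ : Measure Ω} [IsFiniteMeasure μ]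
  {o : Ω → ι} {x : Ω → X}

open Classical in
theorem measureReal_ne_singleton_eq_sum [Fintype ι] [Fintype X]
    (ho : ∀ c, MeasurableSet (o ⁻¹' {c})) (hx : ∀ i, MeasurableSet {ω | x ω = i}) (D : ι → Set X) :
    μ.real {ω | D (o ω) ≠ {x ω}} =
      ∑ c, ∑ i with D c ≠ {i}, μ.real (o ⁻¹' {c} ∩ {ω | x ω = i}) := by
  have hpair (c : ι × X) :
      (fun ω => (o ω, x ω)) ⁻¹' {c} = o ⁻¹' {c.1} ∩ {ω | x ω = c.2} := by
    ext ω
    simp [Prod.ext_iff]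
  have hm (c : ι × X) : MeasurableSet ((fun ω => (o ω, x ω)) ⁻¹' {c}) :=
    hpair c ▸ (ho c.1).inter (hx c.2)
  have hset := sum_measureReal_preimage_singleton (μ := μ)
    (Finset.univ.filter fun c : ι × X => D c.1 ≠ {c.2}) fun c _ => hm c
  simp only [hpair, Finset.sum_filter, Fintype.sum_prod_type] at hset
  simp only [Finset.sum_filter, hset]
  congr 1
  ext ω
  simp

theorem measureReal_mapError_le [Finite ι] [Finite X] (ho : ∀ c, MeasurableSet (o ⁻¹' {c}))
    (hx : ∀ i, MeasurableSet {ω | x ω = i}) {D : Ω → Set X} (hD : D.FactorsThrough o) :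
    μ.real {ω | argmaxSet (fun i =>
        (ProbabilityTheory.cond μ (o ⁻¹' {o ω})).real {ω' | x ω' = i}) ≠ {x ω}} ≤
      2 * μ.real {ω | D ω ≠ {x ω}} := by
  classical
  have _ := Fintype.ofFinite ι
  have _ := Fintype.ofFinite X
  obtain ⟨d, rfl⟩ := (Function.factorsThrough_iff D).1 hD
  let w : ι → X → ℝ := fun c i => μ.real (o ⁻¹' {c} ∩ {ω | x ω = i})
  have hargmax (c : ι) (hc : μ.real (o ⁻¹' {c}) ≠ 0) : argmaxSet (fun i =>
      (ProbabilityTheory.cond μ (o ⁻¹' {c})).real {ω' | x ω' = i}) = argmaxSet (w c) := by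
    have hpos : 0 < (μ.real (o ⁻¹' {c}))⁻¹ := inv_pos.2 (lt_of_le_of_ne measureReal_nonneg hc.symm)
    refine argmaxSet_eq_of_le_iff_le fun i j => ?_
    simp only [measureReal_def, ProbabilityTheory.cond_apply (ho c), ENNReal.toReal_mul,
      ENNReal.toReal_inv] at hpos ⊢
    exact mul_le_mul_iff_right₀ hpos
  rw [measureReal_ne_singleton_eq_sum ho hx (D := fun c => argmaxSet fun i =>
    (ProbabilityTheory.cond μ (o ⁻¹' {c})).real {ω' | x ω' = i})]
  simp only [Function.comp_apply]
  rw [measureReal_ne_singleton_eq_sum ho hx, Finset.mul_sum]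
  refine Finset.sum_le_sum fun c _ => ?_
  by_cases hc : μ.real (o ⁻¹' {c}) = 0
  · have hnull (i : X) : μ.real (o ⁻¹' {c} ∩ {ω | x ω = i}) = 0 :=
      measureReal_mono_null Set.inter_subset_left hc
    simp only [hnull, Finset.sum_const_zero, mul_zero, le_refl]
  · rw [hargmax c hc]
    exact sum_argmaxSet_ne_singleton_le (fun i => measureReal_nonneg) (d c)

end MaximumAPosteriori

namespace ControlledProcess

section Law

variable {X A Y : Type v} {H : ControlledProcess.{u} X A Y} {k : ℕ} {ω ω' : H.Ω}

/-- States and actions up to time `k` and observations at times `1, …, k`, the last shifted to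
start at index `0`. -/
def history (H : ControlledProcess.{u} X A Y) (k : ℕ) (ω : H.Ω) :
    (Fin (k + 1) → X) × (Fin (k + 1) → A) × (Fin k → Y) :=
  (fun i => H.x i ω, fun i => H.a i ω, fun i => H.y (i + 1) ω)

theorem history_eq_iff : H.history k ω = H.history k ω' ↔
    (∀ i ≤ k, H.x i ω = H.x i ω') ∧ (∀ i ≤ k, H.a i ω = H.a i ω') ∧
      ∀ i < k, H.y (i + 1) ω = H.y (i + 1) ω' := by
  simp only [history, Prod.mk.injEq, funext_iff, Fin.forall_iff, Nat.lt_succ_iff]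

theorem preimage_history (ω : H.Ω) {ξ : ℕ → X} {υ : ℕ → Y} (hξ : ∀ i ≤ k, ξ i = H.x i ω)
    (hυ : ∀ i ≤ k, υ i = H.y i ω) :
    H.history k ⁻¹' {H.history k ω} = H.past k ξ (H.a · ω) υ := by
  ext ω'
  simp only [Set.mem_preimage, Set.mem_singleton_iff, history_eq_iff, past, Set.mem_ofPred_eq]
  refine and_congr (forall₂_congr fun i hi => by rw [hξ i hi]) (and_congr_right fun _ =>
    ⟨fun h i hi hik => ?_, fun h i hi => ?_⟩)
  · obtain ⟨i, rfl⟩ := Nat.exists_eq_add_of_le' hi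
    rw [hυ _ hik, h i hik]
  · rw [h (i + 1) i.succ_pos hi, hυ _ hi]

theorem measurableSet_preimage_history (H : ControlledProcess.{u} X A Y) (k : ℕ)
    (c : (Fin (k + 1) → X) × (Fin (k + 1) → A) × (Fin k → Y)) :
    MeasurableSet (H.history k ⁻¹' {c}) := by
  have hc : H.history k ⁻¹' {c} = (⋂ i : Fin (k + 1), {ω | H.x i ω = c.1 i}) ∩
      ((⋂ i : Fin (k + 1), {ω | H.a i ω = c.2.1 i}) ∩
        ⋂ i : Fin k, {ω | H.y (i + 1) ω = c.2.2 i}) := by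
    ext ω
    simp [history, Prod.ext_iff, funext_iff]
  rw [hc]
  exact (MeasurableSet.iInter fun i => H.measurable_x _ _).inter
    ((MeasurableSet.iInter fun i => H.measurable_a _ _).inter
      (MeasurableSet.iInter fun i => H.measurable_y _ _))

theorem measurableSet_preimage_history_prod_x (H : ControlledProcess.{u} X A Y) (k : ℕ)
    (c : ((Fin (k + 1) → X) × (Fin (k + 1) → A) × (Fin k → Y)) × X) :
    MeasurableSet ((fun ω => (H.history k ω, H.x (k + 1) ω)) ⁻¹' {c}) := by
  convert! (H.measurableSet_preimage_history k c.1).inter (H.measurable_x (k + 1) c.2)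
  ext ω
  simp [Prod.ext_iff]

variable [Finite X] [Finite A] {T : A → Matrix X X ℝ} {E : Matrix Y X ℝ} {π₀ : X → ℝ}

theorem IsActionControlledHMM.integral_transition [Fintype X] [Finite Y]
    (hH : H.IsActionControlledHMM T E π₀) {G : H.Ω → X → ℝ}
    (hG : ∀ i, (G · i).FactorsThrough (H.history k)) :
    ∫ ω, G ω (H.x (k + 1) ω) ∂H.μ = ∫ ω, ∑ i, T (H.a k ω) i (H.x k ω) * G ω i ∂H.μ := by
  classical
  refine integral_eq_integral_sum_condLaw (H.measurableSet_preimage_history k) (H.measurable_x _)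
    (p := fun c i => T (c.2.1 (Fin.last k)) i (c.1 (Fin.last k))) (fun ω i => ?_) hG
  have hpast := preimage_history (k := k) ω (ξ := Function.update (H.x · ω) (k + 1) i)
    (υ := (H.y · ω)) (fun j hj => Function.update_of_ne (by lia) _ _) fun _ _ => rfl
  have h := hH.transition k (Function.update (H.x · ω) (k + 1) i) (H.a · ω) (H.y · ω)
  rwa [← hpast, Function.update_self, Function.update_of_ne k.lt_succ_self.ne] at h

theorem IsActionControlledHMM.integral_emission [Fintype Y]
    (hH : H.IsActionControlledHMM T E π₀) {G : H.Ω → Y → ℝ}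
    (hG : ∀ s, (G · s).FactorsThrough fun ω => (H.history k ω, H.x (k + 1) ω)) :
    ∫ ω, G ω (H.y (k + 1) ω) ∂H.μ = ∫ ω, ∑ s, E s (H.x (k + 1) ω) * G ω s ∂H.μ := by
  classical
  refine integral_eq_integral_sum_condLaw (H.measurableSet_preimage_history_prod_x k)
    (H.measurable_y _) (p := fun c s => E s c.2) (fun ω s => ?_) hG
  have hpast := preimage_history (k := k) ω (ξ := (H.x · ω))
    (υ := Function.update (H.y · ω) (k + 1) s) (fun _ _ => rfl)
    fun j hj => Function.update_of_ne (by lia) _ _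
  have hpair : (fun ω => (H.history k ω, H.x (k + 1) ω)) ⁻¹' {(H.history k ω, H.x (k + 1) ω)} =
      H.history k ⁻¹' {H.history k ω} ∩ {ω' | H.x (k + 1) ω' = H.x (k + 1) ω} := by
    ext ω'
    simp [Prod.ext_iff]
  have h := hH.emission k (H.x · ω) (H.a · ω) (Function.update (H.y · ω) (k + 1) s)
  rwa [← hpast, Function.update_self, ← hpair] at h

theorem IsActionControlledHMM.setIntegral_emission [Fintype Y]
    (hH : H.IsActionControlledHMM T E π₀) {S : Set H.Ω} (hS : MeasurableSet S)
    (hS' : (· ∈ S).FactorsThrough fun ω => (H.history k ω, H.x (k + 1) ω)) {G : H.Ω → Y → ℝ}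
    (hG : ∀ s, (G · s).FactorsThrough fun ω => (H.history k ω, H.x (k + 1) ω)) :
    ∫ ω in S, G ω (H.y (k + 1) ω) ∂H.μ = ∫ ω in S, ∑ s, E s (H.x (k + 1) ω) * G ω s ∂H.μ := by
  classical
  rw [← integral_indicator hS, ← integral_indicator hS]
  have hind := hH.integral_emission (G := fun ω s => S.indicator (G · s) ω) fun s ω ω' h => by
    have hmem : ω ∈ S ↔ ω' ∈ S := iff_of_eq (hS' h)
    simp only [Set.indicator_apply, hmem, hG s h]
  refine Eq.trans hind (integral_congr_ae (.of_forall fun ω => ?_))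
  by_cases hω : ω ∈ S <;> simp [hω]

end Law

section Filter

variable {X A Y : Type v} [Fintype X] [DecidableEq X] [Fintype Y] [DecidableEq Y]
  {H : ControlledProcess.{u} X A Y} {P : A → Matrix X X ℝ} {σ : A → Equiv.Perm X}
  {E : Matrix Y X ℝ} {w₀ : X → ℝ} {δ : ℝ} {k : ℕ} {ω ω' : H.Ω}

theorem alf_succ (hP : ∀ a, P a = (σ a).permMatrix ℝ) (k : ℕ) (ω : H.Ω) :
    H.alf P E w₀ δ (k + 1) ω =
      logitStep (σ (H.a k ω)) δ (H.alf P E w₀ δ k ω) (E (H.y (k + 1) ω)) := by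
  ext i
  simp [alf, logitStep, oneHot, hP, Matrix.permMatrix_mulVec]

omit [DecidableEq X] in
theorem alf_congr (ha : ∀ i < k, H.a i ω = H.a i ω')
    (hy : ∀ i < k, H.y (i + 1) ω = H.y (i + 1) ω') :
    H.alf P E w₀ δ k ω = H.alf P E w₀ δ k ω' := by
  induction k with
  | zero => rfl
  | succ k ih =>
    rw [alf, alf, ih (fun i hi => ha i (by lia)) fun i hi => hy i (by lia), ha k (by lia),
      hy k (by lia)]

theorem norm_alf_le {L : ℝ} (hP : ∀ a, P a = (σ a).permMatrix ℝ) (hδ₀ : 0 ≤ δ) (hδ₁ : δ ≤ 1)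
    (hw : ‖w₀‖ ≤ L) (hL : ∀ s, ‖fun i => Real.log (E s i)‖ ≤ L) (k : ℕ) (ω : H.Ω) :
    ‖H.alf P E w₀ δ k ω‖ ≤ L := by
  induction k with
  | zero => exact hw
  | succ k ih =>
    rw [alf_succ hP]
    exact norm_logitStep_le hδ₀ hδ₁ ih (hL _)

end Filter

section Jumps

variable {X A Y : Type v} {H : ControlledProcess.{u} X A Y} {σ : A → Equiv.Perm X} {k₀ j : ℕ}

/-- The event that from time `k₀` to time `k₀ + j` the state always moves according to the
permutations `σ`. As `σ a` sends a row of its permutation matrix to the column of the `1` in that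
row, it takes the new state back to the old one. -/
def noJump (H : ControlledProcess.{u} X A Y) (σ : A → Equiv.Perm X) (k₀ j : ℕ) : Set H.Ω :=
  {ω | ∀ i < j, σ (H.a (k₀ + i) ω) (H.x (k₀ + i + 1) ω) = H.x (k₀ + i) ω}

theorem mem_noJump_succ {ω : H.Ω} : ω ∈ H.noJump σ k₀ (j + 1) ↔ ω ∈ H.noJump σ k₀ j ∧
    σ (H.a (k₀ + j) ω) (H.x (k₀ + j + 1) ω) = H.x (k₀ + j) ω :=
  Nat.forall_lt_succ_right

theorem mem_noJump_congr {ω ω' : H.Ω} (h : H.history (k₀ + j) ω = H.history (k₀ + j) ω') :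
    ω ∈ H.noJump σ k₀ j ↔ ω' ∈ H.noJump σ k₀ j := by
  obtain ⟨hx, ha, -⟩ := history_eq_iff.1 h
  refine forall₂_congr fun i hi => ?_
  rw [ha _ (by lia), hx _ (by lia), hx _ (by lia)]

theorem mem_noJump_succ_congr {ω ω' : H.Ω}
    (h : (H.history (k₀ + j) ω, H.x (k₀ + j + 1) ω) =
      (H.history (k₀ + j) ω', H.x (k₀ + j + 1) ω')) :
    ω ∈ H.noJump σ k₀ (j + 1) ↔ ω' ∈ H.noJump σ k₀ (j + 1) := by
  obtain ⟨hhist, hx'⟩ := Prod.mk.inj h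
  obtain ⟨hx, ha, -⟩ := history_eq_iff.1 hhist
  rw [mem_noJump_succ, mem_noJump_succ, mem_noJump_congr hhist, hx', hx _ le_rfl, ha _ le_rfl]

variable [Finite A]

theorem measurableSet_noJump [Finite X] [Finite Y] : MeasurableSet (H.noJump σ k₀ j) :=
  measurableSet_of_factorsThrough_finite (H.measurableSet_preimage_history (k₀ + j))
    fun _ _ h => propext (mem_noJump_congr h)

variable [Fintype X] {T : A → Matrix X X ℝ} {E : Matrix Y X ℝ} {π₀ : X → ℝ} {η : ℝ}

theorem IsActionControlledHMM.measureReal_jump_le [Finite Y] (hH : H.IsActionControlledHMM T E π₀)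
    (hη : 0 ≤ η) (hT : ∀ a i x, σ a i ≠ x → T a i x ≤ η) (k : ℕ) :
    H.μ.real {ω | σ (H.a k ω) (H.x (k + 1) ω) ≠ H.x k ω} ≤ Fintype.card X * η := by
  classical
  let G : H.Ω → X → ℝ := fun ω i => if σ (H.a k ω) i = H.x k ω then 0 else 1
  have hG (i : X) : (G · i).FactorsThrough (H.history k) := fun ω ω' h => by
    obtain ⟨hx, ha, -⟩ := history_eq_iff.1 h
    simp only [G, hx k le_rfl, ha k le_rfl]
  have hjump : {ω | σ (H.a k ω) (H.x (k + 1) ω) ≠ H.x k ω} = (H.noJump σ k 1)ᶜ := by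
    ext ω
    simp [noJump]
  calc H.μ.real {ω | σ (H.a k ω) (H.x (k + 1) ω) ≠ H.x k ω} = ∫ ω, G ω (H.x (k + 1) ω) ∂H.μ := by
        rw [hjump, ← integral_indicator_one measurableSet_noJump.compl]
        refine integral_congr_ae (.of_forall fun ω => ?_)
        simp [G, noJump, Set.indicator_apply]
    _ = ∫ ω, ∑ i, T (H.a k ω) i (H.x k ω) * G ω i ∂H.μ := hH.integral_transition hG
    _ ≤ ∫ _, Fintype.card X * η ∂H.μ := by
        refine integral_mono ?_ (integrable_const _) fun ω => ?_
        · refine integrable_of_factorsThrough_finite (H.measurableSet_preimage_history k)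
            fun ω ω' h => ?_
          obtain ⟨hx, ha, -⟩ := history_eq_iff.1 h
          simp only [G, hx k le_rfl, ha k le_rfl]
        · refine (Finset.sum_le_card_nsmul _ _ η fun i _ => ?_).trans_eq (by simp)
          simp only [G]
          split_ifs with hi
          · simpa using hη
          · simpa using hT _ i _ hi
    _ = Fintype.card X * η := by simp

theorem IsActionControlledHMM.measureReal_compl_noJump_le [Finite Y]
    (hH : H.IsActionControlledHMM T E π₀) (hη : 0 ≤ η)
    (hT : ∀ a i x, σ a i ≠ x → T a i x ≤ η) (k₀ j : ℕ) :
    H.μ.real (H.noJump σ k₀ j)ᶜ ≤ j * (Fintype.card X * η) := by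
  have hcompl : (H.noJump σ k₀ j)ᶜ = ⋃ i ∈ Finset.range j,
      {ω | σ (H.a (k₀ + i) ω) (H.x (k₀ + i + 1) ω) ≠ H.x (k₀ + i) ω} := by
    ext ω
    simp [noJump]
  calc H.μ.real (H.noJump σ k₀ j)ᶜ
      ≤ ∑ i ∈ Finset.range j,
          H.μ.real {ω | σ (H.a (k₀ + i) ω) (H.x (k₀ + i + 1) ω) ≠ H.x (k₀ + i) ω} :=
        hcompl ▸ measureReal_biUnion_finset_le _ _
    _ ≤ ∑ _i ∈ Finset.range j, Fintype.card X * η :=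
        Finset.sum_le_sum fun i _ => hH.measureReal_jump_le hη hT _
    _ = j * (Fintype.card X * η) := by simp

end Jumps

section Contraction

variable {X A Y : Type v} [Fintype X] [DecidableEq X] [Finite A] [Fintype Y] [DecidableEq Y]
  {H : ControlledProcess.{u} X A Y} {P T : A → Matrix X X ℝ} {σ : A → Equiv.Perm X}
  {E : Matrix Y X ℝ} {π₀ w₀ : X → ℝ} {δ ℓ L : ℝ}

omit [DecidableEq X] in
theorem integrable_comp_alf_x (F : (X → ℝ) → X → ℝ) (k : ℕ) :
    Integrable (fun ω => F (H.alf P E w₀ δ k ω) (H.x k ω)) H.μ := by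
  refine integrable_of_factorsThrough_finite (H.measurableSet_preimage_history k) fun ω ω' h => ?_
  obtain ⟨hx, ha, hy⟩ := history_eq_iff.1 h
  simp only [alf_congr (fun i hi => ha i hi.le) hy, hx k le_rfl]

theorem IsActionControlledHMM.setIntegral_errorPotential_succ_le
    (hH : H.IsActionControlledHMM T E π₀) (hP : ∀ a, P a = (σ a).permMatrix ℝ)
    (hE : IsEmissionMatrix E) (hE_pos : ∀ s j, 0 < E s j) (hℓ : IsSeparationExponent E ℓ)
    {θ : ℝ} (hθ₀ : 0 ≤ θ * δ) (hθ : θ * δ ≤ 1 / 2) (k₀ j : ℕ) :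
    ∫ ω in H.noJump σ k₀ (j + 1),
        errorPotential θ (H.alf P E w₀ δ (k₀ + j + 1) ω) (H.x (k₀ + j + 1) ω) ∂H.μ ≤
      Real.exp (-(2 * (θ * δ) * ℓ)) * ∫ ω in H.noJump σ k₀ j,
        errorPotential ((1 - δ) * θ) (H.alf P E w₀ δ (k₀ + j) ω) (H.x (k₀ + j) ω) ∂H.μ := by
  let V : H.Ω → Y → ℝ := fun ω s => errorPotential θ
    (logitStep (σ (H.a (k₀ + j) ω)) δ (H.alf P E w₀ δ (k₀ + j) ω) (E s)) (H.x (k₀ + j + 1) ω)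
  let U : H.Ω → ℝ := fun ω =>
    errorPotential ((1 - δ) * θ) (H.alf P E w₀ δ (k₀ + j) ω) (H.x (k₀ + j) ω)
  have hU : Integrable (fun ω => Real.exp (-(2 * (θ * δ) * ℓ)) * U ω) H.μ :=
    (integrable_comp_alf_x (errorPotential ((1 - δ) * θ)) (k₀ + j)).const_mul _
  have hV (s : Y) : (V · s).FactorsThrough
      fun ω => (H.history (k₀ + j) ω, H.x (k₀ + j + 1) ω) := fun ω ω' h => by
    obtain ⟨hhist, hx⟩ := Prod.mk.inj h
    obtain ⟨-, ha, hy⟩ := history_eq_iff.1 hhist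
    simp only [V, hx, ha _ le_rfl, alf_congr (fun i hi => ha i hi.le) hy]
  calc _ = ∫ ω in H.noJump σ k₀ (j + 1), V ω (H.y (k₀ + j + 1) ω) ∂H.μ := by
        simp only [alf_succ hP, V]
    _ = ∫ ω in H.noJump σ k₀ (j + 1), ∑ s, E s (H.x (k₀ + j + 1) ω) * V ω s ∂H.μ :=
        hH.setIntegral_emission measurableSet_noJump
          (fun ω ω' h => propext (mem_noJump_succ_congr h)) hV
    _ ≤ ∫ ω in H.noJump σ k₀ (j + 1), Real.exp (-(2 * (θ * δ) * ℓ)) * U ω ∂H.μ := by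
        refine setIntegral_mono_on ?_ hU.integrableOn measurableSet_noJump fun ω hω => ?_
        · refine (integrable_of_factorsThrough_finite
            (H.measurableSet_preimage_history_prod_x (k₀ + j)) fun ω ω' h =>
              Finset.sum_congr rfl fun s _ => ?_).integrableOn
          exact congrArg₂ (E s · * ·) (Prod.mk.inj h).2 (hV s h)
        · simp only [U, ← (mem_noJump_succ.1 hω).2]
          exact sum_mul_errorPotential_logitStep_le hE hE_pos hℓ hθ₀ hθ _ _ _
    _ ≤ ∫ ω in H.noJump σ k₀ j, Real.exp (-(2 * (θ * δ) * ℓ)) * U ω ∂H.μ :=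
        setIntegral_mono_set hU.integrableOn
          (.of_forall fun ω => mul_nonneg (Real.exp_pos _).le (errorPotential_nonneg _ _ _))
          (.of_forall fun ω hω => (mem_noJump_succ.1 hω).1)
    _ = _ := integral_const_mul _ _

theorem IsActionControlledHMM.setIntegral_errorPotential_le
    (hH : H.IsActionControlledHMM T E π₀) (hP : ∀ a, P a = (σ a).permMatrix ℝ)
    (hE : IsEmissionMatrix E) (hE_pos : ∀ s j, 0 < E s j) (hℓ : IsSeparationExponent E ℓ)
    (hδ₀ : 0 ≤ δ) (hδ₁ : δ ≤ 1) (hw : ‖w₀‖ ≤ L) (hL : ∀ s, ‖fun i => Real.log (E s i)‖ ≤ L)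
    (k₀ j : ℕ) {θ : ℝ} (hθ₀ : 0 ≤ θ) (hθ : θ * δ ≤ 1 / 2) :
    ∫ ω in H.noJump σ k₀ j,
        errorPotential θ (H.alf P E w₀ δ (k₀ + j) ω) (H.x (k₀ + j) ω) ∂H.μ ≤
      Fintype.card X * Real.exp (2 * θ * ((1 - δ) ^ j * L - ℓ * (1 - (1 - δ) ^ j))) := by
  induction j generalizing θ with
  | zero =>
    calc _ ≤ ∫ _ in H.noJump σ k₀ 0, Fintype.card X * Real.exp (2 * θ * L) ∂H.μ :=
          integral_mono (integrable_comp_alf_x _ _).integrableOn (integrable_const _) fun ω =>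
            errorPotential_le hθ₀ (norm_alf_le hP hδ₀ hδ₁ hw hL _ ω) _
      _ = _ := by simp [noJump]
  | succ j ih =>
    have hθ' : (1 - δ) * θ * δ ≤ 1 / 2 := by nlinarith [mul_nonneg hθ₀ hδ₀]
    refine (hH.setIntegral_errorPotential_succ_le hP hE hE_pos hℓ (mul_nonneg hθ₀ hδ₀) hθ
      k₀ j).trans ?_
    refine (mul_le_mul_of_nonneg_left (ih (mul_nonneg (sub_nonneg.2 hδ₁) hθ₀) hθ')
      (Real.exp_pos _).le).trans_eq ?_
    rw [mul_left_comm, ← Real.exp_add]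
    ring_nf

theorem IsActionControlledHMM.alfError_le {η : ℝ} (hH : H.IsActionControlledHMM T E π₀)
    (hP : ∀ a, P a = (σ a).permMatrix ℝ) (hη : 0 ≤ η) (hT : ∀ a i x, σ a i ≠ x → T a i x ≤ η)
    (hE : IsEmissionMatrix E) (hE_pos : ∀ s j, 0 < E s j) (hℓ : IsSeparationExponent E ℓ)
    (hδ₀ : 0 < δ) (hδ₁ : δ ≤ 1) (hw : ‖w₀‖ ≤ L) (hL : ∀ s, ‖fun i => Real.log (E s i)‖ ≤ L)
    (k₀ j : ℕ) :
    H.alfError P E w₀ δ (k₀ + j) ≤ j * (Fintype.card X * η) +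
      Fintype.card X * Real.exp (((1 - δ) ^ j * L - ℓ * (1 - (1 - δ) ^ j)) / δ) := by
  -- the largest exponent `θ` for which the Bhattacharyya bound contracts the potential
  let θ := 1 / (2 * δ)
  have hθ₀ : 0 ≤ θ := by positivity
  let U : H.Ω → ℝ := fun ω => errorPotential θ (H.alf P E w₀ δ (k₀ + j) ω) (H.x (k₀ + j) ω)
  have hmarkov : H.μ.real ({ω | 1 ≤ U ω} ∩ H.noJump σ k₀ j) ≤ ∫ ω in H.noJump σ k₀ j, U ω ∂H.μ := by
    have hU : Integrable U H.μ := integrable_comp_alf_x _ _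
    rw [← measureReal_restrict_apply' measurableSet_noJump, ← one_mul (Measure.real _ _)]
    exact mul_meas_ge_le_integral_of_nonneg (.of_forall fun ω => errorPotential_nonneg _ _ _)
      hU.integrableOn 1
  have hsub : {ω | argmaxSet (softmax (H.alf P E w₀ δ (k₀ + j) ω)) ≠ {H.x (k₀ + j) ω}} ⊆
      (H.noJump σ k₀ j)ᶜ ∪ ({ω | 1 ≤ U ω} ∩ H.noJump σ k₀ j) := fun ω hω => by
    by_cases hjump : ω ∈ H.noJump σ k₀ j
    · exact .inr ⟨one_le_errorPotential hθ₀ (argmaxSet_softmax (H.alf P E w₀ δ (k₀ + j) ω) ▸ hω),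
        hjump⟩
    · exact .inl hjump
  calc H.alfError P E w₀ δ (k₀ + j)
      ≤ H.μ.real (H.noJump σ k₀ j)ᶜ + H.μ.real ({ω | 1 ≤ U ω} ∩ H.noJump σ k₀ j) :=
        (measureReal_mono hsub).trans (measureReal_union_le _ _)
    _ ≤ j * (Fintype.card X * η) + Fintype.card X *
          Real.exp (2 * θ * ((1 - δ) ^ j * L - ℓ * (1 - (1 - δ) ^ j))) :=
        add_le_add (hH.measureReal_compl_noJump_le hη hT k₀ j) <| hmarkov.trans <|
          hH.setIntegral_errorPotential_le hP hE hE_pos hℓ hδ₀.le hδ₁ hw hL k₀ j hθ₀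
            (by simp only [θ]; field_simp; rfl)
    _ = _ := by
        congr 3
        simp only [θ]
        field_simp

end Contraction

section Bayes

variable {X A Y : Type v}

/-- The data available to a decoder at time `k`: the actions `a_0, …, a_{k-1}` and the observations
`y_1, …, y_k`. -/
def observations (H : ControlledProcess.{u} X A Y) (k : ℕ) (ω : H.Ω) : Fin k → A × Y :=
  fun i => (H.a i ω, H.y (i + 1) ω)

theorem observations_eq_iff {H : ControlledProcess.{u} X A Y} {k : ℕ} {ω ω' : H.Ω} :
    H.observations k ω = H.observations k ω' ↔
      (∀ i < k, H.a i ω = H.a i ω') ∧ ∀ i < k, H.y (i + 1) ω = H.y (i + 1) ω' := by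
  simp only [observations, funext_iff, Prod.mk.injEq, Fin.forall_iff, forall₂_and]

theorem preimage_observations (H : ControlledProcess.{u} X A Y) (k : ℕ) (ω : H.Ω) :
    H.observations k ⁻¹' {H.observations k ω} = H.observedHistory k ω := by
  ext ω'
  simp only [Set.mem_preimage, Set.mem_singleton_iff, observations_eq_iff, observedHistory,
    Set.mem_ofPred_eq]
  refine and_comm.trans (and_congr_left fun _ =>
    ⟨fun h i hi hik => ?_, fun h i hi => h _ i.succ_pos hi⟩)
  obtain ⟨i, rfl⟩ := Nat.exists_eq_add_of_le' hi
  exact h i hik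

theorem measurableSet_preimage_observations (H : ControlledProcess.{u} X A Y) (k : ℕ)
    (c : Fin k → A × Y) : MeasurableSet (H.observations k ⁻¹' {c}) := by
  have hc : H.observations k ⁻¹' {c} =
      ⋂ i : Fin k, {ω | H.a i ω = (c i).1} ∩ {ω | H.y (i + 1) ω = (c i).2} := by
    ext ω
    simp [observations, funext_iff, Prod.ext_iff]
  rw [hc]
  exact .iInter fun i => (H.measurable_a _ _).inter (H.measurable_y _ _)

theorem bayesError_le_two_mul_alfError [Fintype X] [Finite A] [Fintype Y] [DecidableEq Y]
    (H : ControlledProcess.{u} X A Y)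
    (P : A → Matrix X X ℝ) (E : Matrix Y X ℝ) (w₀ : X → ℝ) (δ : ℝ) (k : ℕ) :
    H.bayesError k ≤ 2 * H.alfError P E w₀ δ k := by
  have hD : (fun ω => argmaxSet (softmax (H.alf P E w₀ δ k ω))).FactorsThrough
      (H.observations k) := fun ω ω' h => by
    obtain ⟨ha, hy⟩ := observations_eq_iff.1 h
    simp only [alf_congr ha hy]
  have hmap := measureReal_mapError_le (μ := H.μ) (H.measurableSet_preimage_observations k)
    (H.measurable_x k) hD
  simp only [preimage_observations] at hmap
  exact hmap

end Bayes

end ControlledProcess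

section Asymptotics

theorem one_sub_pow_natCeil_le {c δ : ℝ} (hδ₀ : 0 < δ) (hδ₁ : δ ≤ 1) :
    (1 - δ) ^ ⌈c / δ⌉₊ ≤ Real.exp (-c) :=
  calc (1 - δ) ^ ⌈c / δ⌉₊ ≤ Real.exp (-δ) ^ ⌈c / δ⌉₊ :=
        pow_le_pow_left₀ (sub_nonneg.2 hδ₁) (Real.one_sub_le_exp_neg δ) _
    _ = Real.exp (-(⌈c / δ⌉₊ * δ)) := by rw [← Real.exp_nat_mul, mul_neg]
    _ ≤ Real.exp (-c) := Real.exp_le_exp.2 (neg_le_neg ((div_le_iff₀ hδ₀).1 (Nat.le_ceil _)))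

-- After this many steps the initial margin `L` has been forgotten down to half of the drift `ℓ`.
theorem forgotten_margin_le {δ ℓ L : ℝ} (hδ₀ : 0 < δ) (hδ₁ : δ ≤ 1) (hℓ₀ : 0 < ℓ) (hL₀ : 0 ≤ L)
    {m : ℕ} (hm : m = ⌈Real.log (2 * (L + ℓ) / ℓ) / δ⌉₊) :
    (1 - δ) ^ m * L - ℓ * (1 - (1 - δ) ^ m) ≤ -(ℓ / 2) := by
  have hpow : (1 - δ) ^ m * (L + ℓ) ≤ ℓ / 2 :=
    calc (1 - δ) ^ m * (L + ℓ) ≤ Real.exp (-Real.log (2 * (L + ℓ) / ℓ)) * (L + ℓ) := by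
          rw [hm]
          gcongr
          exact one_sub_pow_natCeil_le hδ₀ hδ₁
      _ = ℓ / 2 := by
          rw [Real.exp_neg, Real.exp_log (by positivity)]
          field_simp
  linarith

theorem natCeil_div_le {c δ : ℝ} (hc : 0 ≤ c) (hδ₀ : 0 < δ) (hδ₁ : δ ≤ 1) :
    (⌈c / δ⌉₊ : ℝ) ≤ (c + 1) / δ :=
  calc (⌈c / δ⌉₊ : ℝ) ≤ c / δ + 1 := (Nat.ceil_lt_add_one (by positivity)).le
    _ ≤ c / δ + 1 / δ := by gcongr; exact (one_le_div hδ₀).2 hδ₁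
    _ = (c + 1) / δ := (add_div _ _ _).symm

theorem limsup_le_of_nonneg_of_eventually_le {u : ℕ → ℝ} {b : ℝ} (hu : ∀ k, 0 ≤ u k)
    (h : ∀ᶠ k in atTop, u k ≤ b) : limsup u atTop ≤ b :=
  limsup_le_of_le (isCoboundedUnder_le_of_le _ hu) h

theorem tendsto_log_one_div_nhdsGT_zero :
    Tendsto (fun ε : ℝ => Real.log (1 / ε)) (𝓝[>] 0) atTop := by
  simpa only [one_div, Function.comp_def] using
    Real.tendsto_log_atTop.comp (tendsto_inv_nhdsGT_zero (𝕜 := ℝ))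

theorem exp_neg_mul_log_div_le {ε lam r : ℝ} (hε : 0 < ε) (hlog : 1 ≤ Real.log (1 / ε))
    (hlam₀ : 0 < lam) (hlam : lam ≤ r) :
    Real.exp (-(r / (lam / Real.log (1 / ε)))) ≤ ε * Real.log (1 / ε) :=
  calc Real.exp (-(r / (lam / Real.log (1 / ε)))) ≤ Real.exp (-Real.log (1 / ε)) := by
        refine Real.exp_le_exp.2 (neg_le_neg ?_)
        rw [div_div_eq_mul_div, le_div_iff₀ hlam₀, mul_comm]
        gcongr
    _ = ε := by rw [one_div, Real.log_inv, neg_neg, Real.exp_log hε]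
    _ ≤ ε * Real.log (1 / ε) := le_mul_of_one_le_right hε.le hlog

theorem exists_eventually_forall_le_mul {ι : Type*} [Finite ι] {l : Filter ℝ} (p : ι → Prop)
    {f : ℝ → ι → ℝ} (hf : ∀ i, p i → (f · i) =O[l] id) (hl : ∀ᶠ ε in l, 0 < ε) :
    ∃ q, 0 < q ∧ ∀ᶠ ε in l, ∀ i, p i → f ε i ≤ q * ε := by
  classical
  have _ := Fintype.ofFinite ι
  have hO : (fun ε (i : {i // p i}) => f ε i) =O[l] id := isBigO_pi.2 fun i => hf i i.2
  obtain ⟨q, hq, h⟩ := hO.exists_pos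
  refine ⟨q, hq, ?_⟩
  filter_upwards [h.bound, hl] with ε hε hpos i hi
  calc f ε i ≤ ‖fun i : {i // p i} => f ε i‖ :=
        (le_abs_self _).trans (norm_le_pi_norm (fun i : {i // p i} => f ε i) ⟨i, hi⟩)
    _ ≤ q * ‖ε‖ := hε
    _ = q * ε := by rw [Real.norm_of_nonneg hpos.le]

end Asymptotics

namespace ControlledProcess

variable {X A Y : Type v} [Fintype X] [DecidableEq X] [Finite A] [Fintype Y] [DecidableEq Y]
  {P : A → Matrix X X ℝ} {E : Matrix Y X ℝ} {ℓ : ℝ}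

theorem exists_forall_eventually_alfError_le (hP : ∀ a, IsPermutationMatrix (P a))
    (hE : IsEmissionMatrix E) (hE_pos : ∀ s j, 0 < E s j) (hℓ₀ : 0 < ℓ)
    (hℓ : IsSeparationExponent E ℓ) (w₀ : X → ℝ) :
    ∃ C, 0 < C ∧ ∀ (T : A → Matrix X X ℝ) (π₀ : X → ℝ) (H : ControlledProcess.{u} X A Y)
      (η δ : ℝ), 0 ≤ η → (∀ a i j, P a i j = 0 → T a i j ≤ η) → 0 < δ → δ ≤ 1 →
      H.IsActionControlledHMM T E π₀ →
      ∀ᶠ k in atTop, H.alfError P E w₀ δ k ≤ C * (η / δ + Real.exp (-(ℓ / 2 / δ))) := by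
  choose σ hσ using hP
  set L := max ‖w₀‖ ‖fun s i => Real.log (E s i)‖
  have hw : ‖w₀‖ ≤ L := le_max_left _ _
  have hL (s : Y) : ‖fun i => Real.log (E s i)‖ ≤ L :=
    (norm_le_pi_norm (fun s i => Real.log (E s i)) s).trans (le_max_right _ _)
  have hL₀ : 0 ≤ L := (norm_nonneg _).trans hw
  set c := Real.log (2 * (L + ℓ) / ℓ) with hc
  have hc₀ : 0 ≤ c := Real.log_nonneg ((one_le_div hℓ₀).2 (by linarith))
  refine ⟨(c + 1) * (Fintype.card X + 1), by positivity,
    fun T π₀ H η δ hη hT hδ₀ hδ₁ hH => ?_⟩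
  have hT' (a : A) (i x : X) (hix : σ a i ≠ x) : T a i x ≤ η :=
    hT a i x (by simp [hσ, Equiv.Perm.permMatrix, PEquiv.toMatrix_apply, hix])
  set m := ⌈c / δ⌉₊ with hm
  filter_upwards [eventually_ge_atTop m] with k hk
  obtain ⟨k₀, rfl⟩ := Nat.exists_eq_add_of_le' hk
  calc H.alfError P E w₀ δ (k₀ + m)
      ≤ m * (Fintype.card X * η) + Fintype.card X *
          Real.exp (((1 - δ) ^ m * L - ℓ * (1 - (1 - δ) ^ m)) / δ) :=
        hH.alfError_le hσ hη hT' hE hE_pos hℓ hδ₀ hδ₁ hw hL k₀ m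
    _ ≤ (c + 1) / δ * ((Fintype.card X + 1) * η) + (c + 1) * (Fintype.card X + 1) *
          Real.exp (-(ℓ / 2) / δ) := by
        gcongr
        · exact natCeil_div_le hc₀ hδ₀ hδ₁
        · linarith
        · nlinarith [Nat.cast_nonneg (α := ℝ) (Fintype.card X)]
        · exact forgotten_margin_le hδ₀ hδ₁ hℓ₀ hL₀ (by rw [hm, hc])
    _ = _ := by ring_nf

theorem tendsto_limsup_alfError_zero (hP : ∀ a, IsPermutationMatrix (P a))
    (hE : IsEmissionMatrix E) (hE_pos : ∀ s j, 0 < E s j) (hℓ₀ : 0 < ℓ)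
    (hℓ : IsSeparationExponent E ℓ) (w₀ : X → ℝ) {ι : Type*} {l : Filter ι}
    {T : ι → A → Matrix X X ℝ} {π₀ : ι → X → ℝ} {H : ι → ControlledProcess.{u} X A Y}
    (hH : ∀ᶠ ε in l, (H ε).IsActionControlledHMM (T ε) E (π₀ ε)) {η δ : ι → ℝ}
    (hη : ∀ᶠ ε in l, 0 ≤ η ε) (hT : ∀ᶠ ε in l, ∀ a i j, P a i j = 0 → T ε a i j ≤ η ε)
    (hδ₀ : ∀ᶠ ε in l, 0 < δ ε) (hδ : Tendsto δ l (𝓝 0))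
    (hηδ : Tendsto (fun ε => η ε / δ ε) l (𝓝 0)) :
    Tendsto (fun ε => limsup (fun k => (H ε).alfError P E w₀ (δ ε) k) atTop) l (𝓝 0) := by
  obtain ⟨C, -, hC⟩ := exists_forall_eventually_alfError_le.{u} hP hE hE_pos hℓ₀ hℓ w₀
  have hexp : Tendsto (fun ε => Real.exp (-(ℓ / 2 / δ ε))) l (𝓝 0) := by
    have hδ' : Tendsto δ l (𝓝[>] 0) := tendsto_nhdsWithin_iff.2 ⟨hδ, hδ₀⟩
    exact Real.tendsto_exp_neg_atTop_nhds_zero.comp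
      ((tendsto_inv_nhdsGT_zero.comp hδ').const_mul_atTop (half_pos hℓ₀))
  have hbound := (hηδ.add hexp).const_mul C
  rw [add_zero, mul_zero] at hbound
  refine tendsto_of_tendsto_of_tendsto_of_le_of_le' tendsto_const_nhds hbound
    (.of_forall fun ε => ?_) ?_
  · exact le_limsup_of_frequently_le (.of_forall fun _ => measureReal_nonneg)
      (isBoundedUnder_of_eventually_le (a := 1) (.of_forall fun _ => measureReal_le_one))
  · filter_upwards [hH, hη, hT, hδ₀, hδ.eventually_le_const one_pos] with ε hHε hηε hTε hδε hδε₁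
    exact limsup_le_of_nonneg_of_eventually_le (fun _ => measureReal_nonneg)
      (hC _ _ _ _ _ hηε hTε hδε hδε₁ hHε)

theorem exists_eventually_alfError_le_mul_log (hP : ∀ a, IsPermutationMatrix (P a))
    (hE : IsEmissionMatrix E) (hE_pos : ∀ s j, 0 < E s j) (hℓ₀ : 0 < ℓ)
    (hℓ : IsSeparationExponent E ℓ) (w₀ : X → ℝ) {lam q : ℝ} (hlam₀ : 0 < lam)
    (hlam : lam ≤ ℓ / 2) (hq : 0 ≤ q) :
    ∃ κ, 0 < κ ∧ ∀ᶠ ε in 𝓝[>] (0 : ℝ), ∀ (T : A → Matrix X X ℝ) (π₀ : X → ℝ)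
      (H : ControlledProcess.{u} X A Y), (∀ a i j, P a i j = 0 → T a i j ≤ q * ε) →
      H.IsActionControlledHMM T E π₀ → ∀ᶠ k in atTop,
        H.alfError P E w₀ (lam / Real.log (1 / ε)) k ≤ κ * (ε * Real.log (1 / ε)) := by
  obtain ⟨C, hC₀, hC⟩ := exists_forall_eventually_alfError_le.{u} hP hE hE_pos hℓ₀ hℓ w₀
  refine ⟨C * (q / lam + 1), by positivity, ?_⟩
  filter_upwards [self_mem_nhdsWithin,
    tendsto_log_one_div_nhdsGT_zero.eventually_ge_atTop (max lam 1)]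
    with ε (hε : 0 < ε) hlog T π₀ H hT hH
  have hlog₁ : 1 ≤ Real.log (1 / ε) := (le_max_right _ _).trans hlog
  have hlog₀ : 0 < Real.log (1 / ε) := one_pos.trans_le hlog₁
  have hδ₁ : lam / Real.log (1 / ε) ≤ 1 := (div_le_one hlog₀).2 ((le_max_left _ _).trans hlog)
  filter_upwards [hC T π₀ H _ _ (by positivity) hT (div_pos hlam₀ hlog₀) hδ₁ hH] with k hk
  calc _ ≤ C * (q * ε / (lam / Real.log (1 / ε)) +
          Real.exp (-(ℓ / 2 / (lam / Real.log (1 / ε))))) := hk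
    _ ≤ C * (q * ε / (lam / Real.log (1 / ε)) + ε * Real.log (1 / ε)) := by
        gcongr
        exact exp_neg_mul_log_div_le hε hlog₁ hlam₀ hlam
    _ = C * (q / lam + 1) * (ε * Real.log (1 / ε)) := by field_simp

end ControlledProcess

open ControlledProcess in
theorem theorem3_general {X A Y : Type v} [Fintype X] [DecidableEq X] [Finite A]
    [Fintype Y] [DecidableEq Y]
    (P : A → Matrix X X ℝ) (hP : ∀ a, IsPermutationMatrix (P a))
    (E : Matrix Y X ℝ) (hE : IsEmissionMatrix E) (hE_pos : ∀ s j, 0 < E s j)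
    (hE_col : ∀ i j, i ≠ j → E.col i ≠ E.col j) :
    (∀ T : ℝ → A → Matrix X X ℝ, (∀ a i j, P a i j = 0 → (T · a i j) =O[𝓝[>] 0] id) →
      ∀ (w₀ : X → ℝ) (π₀ : ℝ → X → ℝ) (H : ℝ → ControlledProcess.{u} X A Y),
        (∀ᶠ ε in 𝓝[>] (0 : ℝ), (H ε).IsActionControlledHMM (T ε) E (π₀ ε)) →
      ∀ δ : ℝ → ℝ, (∀ᶠ ε in 𝓝[>] (0 : ℝ), 0 < δ ε) →
        Tendsto δ (𝓝[>] 0) (𝓝 0) → Tendsto (fun ε => ε / δ ε) (𝓝[>] 0) (𝓝 0) →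
        Tendsto (fun ε => limsup (fun k => (H ε).alfError P E w₀ (δ ε) k) atTop)
          (𝓝[>] 0) (𝓝 0)) ∧
    (∃ ξ : ℝ, 0 < ξ ∧
      ∀ T : ℝ → A → Matrix X X ℝ, (∀ a i j, P a i j = 0 → (T · a i j) =O[𝓝[>] 0] id) →
      ∀ (w₀ : X → ℝ) (lam : ℝ), 0 < lam → lam < ξ →
      ∃ κ : ℝ, 0 < κ ∧
        ∀ (π₀ : ℝ → X → ℝ) (H : ℝ → ControlledProcess.{u} X A Y),
          (∀ᶠ ε in 𝓝[>] (0 : ℝ), (H ε).IsActionControlledHMM (T ε) E (π₀ ε)) →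
          ∀ᶠ ε in 𝓝[>] (0 : ℝ),
            limsup (fun k => (H ε).alfError P E w₀ (lam / Real.log (1 / ε)) k) atTop ≤
              κ * (ε * Real.log (1 / ε))) ∧
    (∀ T : ℝ → A → Matrix X X ℝ, (∀ a i j, P a i j = 0 → (T · a i j) =O[𝓝[>] 0] id) →
      ∃ κ : ℝ, 0 < κ ∧
        ∀ (π₀ : ℝ → X → ℝ) (H : ℝ → ControlledProcess.{u} X A Y),
          (∀ᶠ ε in 𝓝[>] (0 : ℝ), (H ε).IsActionControlledHMM (T ε) E (π₀ ε)) →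
          ∀ᶠ ε in 𝓝[>] (0 : ℝ),
            limsup (fun k => (H ε).bayesError k) atTop ≤ κ * (ε * Real.log (1 / ε))) := by
  obtain ⟨ℓ, hℓ₀, hℓ⟩ := exists_isSeparationExponent hE hE_col
  have leakage (T : ℝ → A → Matrix X X ℝ)
      (hT : ∀ a i j, P a i j = 0 → (T · a i j) =O[𝓝[>] 0] id) :
      ∃ q, 0 < q ∧ ∀ᶠ ε in 𝓝[>] (0 : ℝ), ∀ a i j, P a i j = 0 → T ε a i j ≤ q * ε := by
    simpa only [Prod.forall] using exists_eventually_forall_le_mul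
      (fun c : A × X × X => P c.1 c.2.1 c.2.2 = 0) (fun c => hT c.1 c.2.1 c.2.2)
      self_mem_nhdsWithin
  refine ⟨fun T hT w₀ π₀ H hH δ hδ₀ hδ hεδ => ?_,
    ⟨ℓ / 2, half_pos hℓ₀, fun T hT w₀ lam hlam₀ hlam => ?_⟩, fun T hT => ?_⟩ <;>
    obtain ⟨q, hq, hTq⟩ := leakage T hT
  · refine tendsto_limsup_alfError_zero hP hE hE_pos hℓ₀ hℓ w₀ hH
      (eventually_mem_nhdsWithin.mono fun ε hε => (mul_pos hq hε).le) hTq hδ₀ hδ ?_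
    simpa only [mul_div_assoc, mul_zero] using hεδ.const_mul q
  · obtain ⟨κ, hκ, h⟩ := exists_eventually_alfError_le_mul_log.{u} hP hE hE_pos hℓ₀ hℓ w₀ hlam₀
      hlam.le hq.le
    refine ⟨κ, hκ, fun π₀ H hH => ?_⟩
    filter_upwards [h, hTq, hH] with ε hε hTε hHε
    exact limsup_le_of_nonneg_of_eventually_le (fun _ => measureReal_nonneg) (hε _ _ _ hTε hHε)
  · obtain ⟨κ, hκ, h⟩ := exists_eventually_alfError_le_mul_log.{u} hP hE hE_pos hℓ₀ hℓ 0
      (half_pos hℓ₀) le_rfl hq.le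
    refine ⟨2 * κ, by positivity, fun π₀ H hH => ?_⟩
    filter_upwards [h, hTq, hH] with ε hε hTε hHε
    refine limsup_le_of_nonneg_of_eventually_le (fun _ => measureReal_nonneg) ?_
    filter_upwards [hε _ _ _ hTε hHε] with k hk
    linarith [(H ε).bayesError_le_two_mul_alfError P E 0 (ℓ / 2 / Real.log (1 / ε)) k]

theorem theorem3 {X A Y : Type v} [Fintype X] [DecidableEq X] [Fintype A]
    [Fintype Y] [DecidableEq Y]
    (P : A → Matrix X X ℝ) (hP : ∀ a, IsPermutationMatrix (P a))
    (E : Matrix Y X ℝ) (hE : IsEmissionMatrix E) (hE_pos : ∀ s j, 0 < E s j)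
    (hE_col : ∀ i j, i ≠ j → E.col i ≠ E.col j) :
    -- consistency
    (∀ Q : A → Matrix X X ℝ, (∀ a, IsDrift (P a) (Q a)) →
      ∀ (w₀ π₀ : X → ℝ) (H : ℝ → ControlledProcess.{u} X A Y),
        (∀ᶠ ε in 𝓝[>] (0 : ℝ), (H ε).IsActionControlledHMM (fun a => P a + ε • Q a) E π₀) →
      ∀ δ : ℝ → ℝ, (∀ᶠ ε in 𝓝[>] (0 : ℝ), 0 < δ ε) →
        Tendsto δ (𝓝[>] 0) (𝓝 0) → Tendsto (fun ε => ε / δ ε) (𝓝[>] 0) (𝓝 0) →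
        Tendsto (fun ε => limsup (fun k => (H ε).alfError P E w₀ (δ ε) k) atTop)
          (𝓝[>] 0) (𝓝 0)) ∧
    -- rate, with a threshold `ξ` that depends only on `P` and `E`
    (∃ ξ : ℝ, 0 < ξ ∧
      ∀ Q : A → Matrix X X ℝ, (∀ a, IsDrift (P a) (Q a)) →
      ∀ (w₀ : X → ℝ) (lam : ℝ), 0 < lam → lam < ξ →
      ∃ κ : ℝ, 0 < κ ∧
        ∀ (π₀ : X → ℝ) (H : ℝ → ControlledProcess.{u} X A Y),
          (∀ᶠ ε in 𝓝[>] (0 : ℝ), (H ε).IsActionControlledHMM (fun a => P a + ε • Q a) E π₀) →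
          ∃ r : ℝ → ℝ, r =o[𝓝[>] 0] (fun ε => ε * Real.log (1 / ε)) ∧
            ∀ᶠ ε in 𝓝[>] (0 : ℝ),
              limsup (fun k => (H ε).alfError P E w₀ (lam / Real.log (1 / ε)) k) atTop ≤
                κ * (ε * Real.log (1 / ε)) + r ε) ∧
    -- the long-run error of the Bayes-optimal decoder is dominated by a term of the same order
    (∀ Q : A → Matrix X X ℝ, (∀ a, IsDrift (P a) (Q a)) →
      ∃ κ : ℝ, 0 < κ ∧
        ∀ (π₀ : X → ℝ) (H : ℝ → ControlledProcess.{u} X A Y),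
          (∀ᶠ ε in 𝓝[>] (0 : ℝ), (H ε).IsActionControlledHMM (fun a => P a + ε • Q a) E π₀) →
          ∃ r : ℝ → ℝ, r =o[𝓝[>] 0] (fun ε => ε * Real.log (1 / ε)) ∧
            ∀ᶠ ε in 𝓝[>] (0 : ℝ),
              limsup (fun k => (H ε).bayesError k) atTop ≤
                κ * (ε * Real.log (1 / ε)) + r ε) := by
  obtain ⟨consistency, ⟨ξ, hξ, rate⟩, bayes⟩ := theorem3_general.{u} P hP E hE hE_pos hE_col
  have hT (Q : A → Matrix X X ℝ) (a : A) (i j : X) (h : P a i j = 0) :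
      (fun ε : ℝ => (P a + ε • Q a) i j) =O[𝓝[>] 0] id := by
    simpa [h, mul_comm] using isBigO_const_mul_self (Q a i j) id (𝓝[>] (0 : ℝ))
  refine ⟨fun Q _ w₀ π₀ => consistency _ (hT Q) w₀ fun _ => π₀, ⟨ξ, hξ, fun Q _ w₀ lam hlam₀ hlam =>
    (rate _ (hT Q) w₀ lam hlam₀ hlam).imp fun κ h => ⟨h.1, fun π₀ H hH => ?_⟩⟩,
    fun Q _ => (bayes _ (hT Q)).imp fun κ h => ⟨h.1, fun π₀ H hH => ?_⟩⟩
  all_goals exact ⟨0, isLittleO_zero _ _, by simpa using h.2 (fun _ => π₀) H hH⟩
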